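/- Let $U,V\subset\mathbb R^n$ be $0$-symmetric closed convex bodies (compact convex sets with non-empty interior, $U=-U$, $V=-V$), let $|\cdot|$ denote volume and $V+U$ the Minkowski sum. Let $$C_n(U,V)=\sup_{f}\frac{\frac1{|V|}\int_V f(x)\,dx}{\frac1{|U|}\int_U f(x)\,dx},$$ where the supremum is over all continuous functions $f:\mathbb R^n\to[0,\infty)$, $f\neq 0$, that are positive definite, i.e. $\sum_{a,b\in X}c_a\overline{c_b}f(a-b)\ge 0$ for every finite $X\subset\mathbb R^n$ and all complex numbers $c_a$ ($a\in X$). There is a sequence of real numbers $\varepsilon_n$ with $\varepsilon_n=o(n)$ as $n\to\infty$ such that for every $n\ge 2$ and all $0$-symmetric closed convex bodies $U,V\subset\mathbb R^n$ $$C_n(U,V)\le 2^n\,(n\ln n+n\ln\ln n+n+\varepsilon_n)\,\frac{|V+U|}{|V|}.$$ In particular, with the same $\varepsilon_n$, for every $n\ge2$, every $0$-symmetric closed convex body $U\subset\mathbb R^n$ and every $r>0$, $$C_n(U,rU)\le 2^n\,(n\ln n+n\ln\ln n+n+\varepsilon_n)\,\Bigl(1+\frac1r\Bigr)^n.$$ 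-/

import Mathlib

open MeasureTheory
open scoped Pointwise

/-- A `0`-symmetric closed convex body in `ℝⁿ`: a compact convex set with non-empty interior
which contains `-x` together with `x`. -/
structure IsSymmConvexBody {n : ℕ} (U : Set (EuclideanSpace ℝ (Fin n))) : Prop where
  convex : Convex ℝ U
  isCompact : IsCompact U
  nonempty_interior : (interior U).Nonempty
  neg_mem : ∀ x ∈ U, -x ∈ U

open scoped ComplexOrder in
/-- A continuous function `f : ℝⁿ → ℂ` is positive definite if for every finite `X ⊂ ℝⁿ` and all
complex numbers `c a`, `a ∈ X`, the number `∑_{a, b ∈ X} c a * conj (c b) * f (a - b)` is real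
and non-negative (this is what `0 ≤ z` means for a complex `z`). -/
structure IsPosDefFun {n : ℕ} (f : EuclideanSpace ℝ (Fin n) → ℂ) : Prop where
  continuous : Continuous f
  sum_nonneg : ∀ (X : Finset (EuclideanSpace ℝ (Fin n))) (c : EuclideanSpace ℝ (Fin n) → ℂ),
    0 ≤ ∑ a ∈ X, ∑ b ∈ X, c a * (starRingEnd ℂ) (c b) * f (a - b)

/-- Double positive definite functions: positive definite functions with values in `[0, ∞)`. -/
structure IsDoublePosDef {n : ℕ} (f : EuclideanSpace ℝ (Fin n) → ℝ) : Prop where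
  nonneg : ∀ x, 0 ≤ f x
  posDef : IsPosDefFun (fun x => (f x : ℂ))

/-- The quotient of the mean value of `f` over `V` by the mean value of `f` over `U`. -/
noncomputable def meanRatio {n : ℕ} (U V : Set (EuclideanSpace ℝ (Fin n)))
    (f : EuclideanSpace ℝ (Fin n) → ℝ) : ℝ :=
  (1 / volume.real V * ∫ x in V, f x) / (1 / volume.real U * ∫ x in U, f x)

/-- The sharp constant `Cₙ(U, V)`: the supremum of the quotients of mean values over all double
positive definite functions `f ≠ 0`. It is taken in the extended reals, so that an upper bound
by a real number includes finiteness. -/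
noncomputable def sharpConst {n : ℕ} (U V : Set (EuclideanSpace ℝ (Fin n))) : EReal :=
  ⨆ (f : EuclideanSpace ℝ (Fin n) → ℝ) (_ : IsDoublePosDef f) (_ : f ≠ 0),
    ((meanRatio U V f : ℝ) : EReal)

open ProbabilityTheory

/-! The covering factor can be avoided. Let `p`, `q` be independent and uniform on `U/2`, so `p - q
∈ U`, and let `G a` be the mean of `f (a + p - q)`. Positive definiteness, tested on the law of `a +
p` minus the law of `p`, gives `G a + G (-a) ≤ 2 G 0`, so the integral of `G` over the symmetric set
`V + U` is at most `|V + U| G 0`. Every shift of `V + U` by `p - q` contains `V`, so this integral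
is at least `∫_V f`. The density of `p` is `2 ^ n / |U|`, so `G 0 ≤ 2 ^ n / |U| * ∫_U f`. Hence
`Cₙ(U, V) ≤ 2 ^ n |V + U| / |V|`, and the factor in the theorem is at least 1. -/

/-- Positive definiteness tested on a finite family of points, with repetitions allowed. -/
theorem IsDoublePosDef.sum_family_nonneg {n : ℕ} {f : EuclideanSpace ℝ (Fin n) → ℝ}
    (hf : IsDoublePosDef f) {ι : Type*} [Fintype ι] (x : ι → EuclideanSpace ℝ (Fin n))
    (c : ι → ℝ) : 0 ≤ ∑ i, ∑ j, c i * c j * f (x i - x j) := by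
  classical
  have h := hf.posDef.sum_nonneg (Finset.univ.image x)
    (fun a => ((∑ i with x i = a, c i : ℝ) : ℂ))
  simp only [Complex.conj_ofReal, ← Complex.ofReal_mul, ← Complex.ofReal_sum] at h
  have h' := Complex.zero_le_real.mp h
  -- Coinciding points are merged and their weights added.
  have fiber (F : EuclideanSpace ℝ (Fin n) → ℝ) :
      ∑ a ∈ Finset.univ.image x, (∑ i with x i = a, c i) * F a = ∑ i, c i * F (x i) := by
    rw [← Finset.sum_fiberwise_of_maps_to (s := Finset.univ) (t := Finset.univ.image x) (g := x)
      (fun i _ => Finset.mem_image_of_mem x (Finset.mem_univ i))]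
    refine Finset.sum_congr rfl fun a _ => ?_
    rw [Finset.sum_mul]
    refine Finset.sum_congr rfl fun i hi => ?_
    rw [(Finset.mem_filter.mp hi).2]
  simp only [mul_assoc, ← Finset.mul_sum] at h' ⊢
  simp only [fiber] at h'
  exact h'

theorem IsDoublePosDef.continuous {n : ℕ} {f : EuclideanSpace ℝ (Fin n) → ℝ}
    (hf : IsDoublePosDef f) : Continuous f := by
  exact Complex.continuous_re.comp hf.posDef.continuous

/-- A crude bound, enough for integrability: weights `1, -1` at `x, 0` give `f x + f (-x) ≤ 2 f 0`.
-/
theorem IsDoublePosDef.le_two_mul {n : ℕ} {f : EuclideanSpace ℝ (Fin n) → ℝ}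
    (hf : IsDoublePosDef f) (x : EuclideanSpace ℝ (Fin n)) : f x ≤ 2 * f 0 := by
  have h := hf.sum_family_nonneg ![x, 0] ![1, -1]
  simp [Fin.sum_univ_two] at h
  have := hf.nonneg (-x)
  linarith

/-- If the sums of `h` over the differences of any finite family are nonnegative, then so is the
mean of `h` over the differences of two independent random points. -/
theorem integral_sub_nonneg_of_sum_nonneg {E : Type*} [AddGroup E] [MeasurableSpace E]
    [MeasurableSub₂ E] (P : Measure E) [IsProbabilityMeasure P] {h : E → ℝ} (hm : Measurable h)
    {C : ℝ} (hC : ∀ x, |h x| ≤ C)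
    (hsum : ∀ (N : ℕ) (u : Fin N → E), 0 ≤ ∑ i, ∑ j, h (u i - u j)) :
    0 ≤ ∫ p, h (p.1 - p.2) ∂(P.prod P) := by
  set I := ∫ p, h (p.1 - p.2) ∂(P.prod P) with hI
  -- Expectation of the double sum over `N` independent samples: `N` diagonal terms and `N (N - 1)`
  -- independent pairs. For large `N` the quadratic term dominates, which forces `0 ≤ I`.
  have key (N : ℕ) : 0 ≤ (N : ℝ) * h 0 + N * (N - 1) * I := by
    let M : Measure (Fin N → E) := Measure.pi fun _ => P
    have hint (i j : Fin N) : Integrable (fun u : Fin N → E => h (u i - u j)) M :=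
      .of_bound (C := C) (Measurable.aestronglyMeasurable (by fun_prop)) (.of_forall fun u => hC _)
    have hpair (i j : Fin N) : ∫ u, h (u i - u j) ∂M = if i = j then h 0 else I := by
      split_ifs with hij
      · simp [hij, M]
      · have hind : IndepFun (fun u : Fin N → E => u i) (fun u => u j) M :=
          (iIndepFun_pi (μ := fun _ : Fin N => P) (X := fun _ => id)
            (fun _ => aemeasurable_id)).indepFun hij
        rw [indepFun_iff_map_prod_eq_prod_map_map (measurable_pi_apply i).aemeasurable
          (measurable_pi_apply j).aemeasurable] at hind
        rw [(measurePreserving_eval (fun _ : Fin N => P) i).map_eq,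
          (measurePreserving_eval (fun _ : Fin N => P) j).map_eq] at hind
        rw [hI, ← hind, integral_map (by fun_prop)
          (Measurable.aestronglyMeasurable (by fun_prop))]
    have h0 : 0 ≤ ∫ u, ∑ i, ∑ j, h (u i - u j) ∂M := integral_nonneg fun u => hsum N u
    rw [integral_finsetSum _ fun i _ => integrable_finsetSum _ fun j _ => hint i j] at h0
    simp_rw [integral_finsetSum _ fun j _ => hint _ j, hpair] at h0
    have hrow (i : Fin N) : ∑ j, (if i = j then h 0 else I) = h 0 + (N - 1) * I := by
      have : ∀ j, (if i = j then h 0 else I) = (if i = j then h 0 - I else 0) + I := by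
        intro j; split_ifs <;> ring
      simp only [this, Finset.sum_add_distrib, Finset.sum_ite_eq, Finset.mem_univ, if_true,
        Finset.sum_const, Finset.card_univ, Fintype.card_fin, nsmul_eq_mul]
      ring
    simp only [hrow, Finset.sum_const, Finset.card_univ, Fintype.card_fin, nsmul_eq_mul] at h0
    linarith
  by_contra! hneg
  obtain ⟨N, hN⟩ := exists_nat_gt (h 0 / (-I))
  rw [div_lt_iff₀ (by linarith)] at hN
  have := key (N + 1)
  push_cast at this
  nlinarith [show (0 : ℝ) ≤ N from N.cast_nonneg]

theorem integral_two_mul_sub_add {α : Type*} [MeasurableSpace α] {μ : Measure α}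
    {f g h : α → ℝ} (hf : Integrable f μ) (hg : Integrable g μ) (hh : Integrable h μ) :
    ∫ x, (2 * f x - (g x + h x)) ∂μ = 2 * ∫ x, f x ∂μ - (∫ x, g x ∂μ + ∫ x, h x ∂μ) := by
  have := integral_sub (hf.const_mul 2) (hg.add hh)
  simp only [Pi.add_apply] at this
  rw [this, integral_add hg hh, integral_const_mul]

/-- Averaging over a symmetric set of translates does not increase the mean of a double positive
definite function over the differences of two independent random points. -/
theorem IsDoublePosDef.setIntegral_integral_le {n : ℕ} {f : EuclideanSpace ℝ (Fin n) → ℝ}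
    (hf : IsDoublePosDef f) (P : Measure (EuclideanSpace ℝ (Fin n))) [IsProbabilityMeasure P]
    {S : Set (EuclideanSpace ℝ (Fin n))} (hS : IsCompact S) (hneg : ∀ x ∈ S, -x ∈ S) :
    ∫ a in S, ∫ p, f (a + (p.1 - p.2)) ∂(P.prod P) ≤
      volume.real S * ∫ p, f (p.1 - p.2) ∂(P.prod P) := by
  have hc := hf.continuous
  have : IsFiniteMeasure (volume.restrict S) := ⟨by simpa using hS.measure_lt_top⟩
  have hb (x) : |f x| ≤ 2 * f 0 := by
    rw [abs_of_nonneg (hf.nonneg x)]; exact hf.le_two_mul x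
  have hint (a : EuclideanSpace ℝ (Fin n)) :
      Integrable (fun p : EuclideanSpace ℝ (Fin n) × EuclideanSpace ℝ (Fin n) =>
        f (a + (p.1 - p.2))) (P.prod P) :=
    .of_bound (C := 2 * f 0) (Continuous.aestronglyMeasurable (by fun_prop))
      (.of_forall fun p => hb _)
  set G := fun a => ∫ p, f (a + (p.1 - p.2)) ∂(P.prod P) with hG
  have hG0 : G 0 = ∫ p, f (p.1 - p.2) ∂(P.prod P) := by simp [hG]
  have hpt (a) : G a + G (-a) ≤ 2 * G 0 := by
    have h0 := integral_sub_nonneg_of_sum_nonneg P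
      (h := fun z => 2 * f (0 + z) - (f (a + z) + f (-a + z))) (C := 8 * f 0)
      (Continuous.measurable (by fun_prop)) (fun z => by
        have h1 := hf.nonneg (0 + z); have h2 := hf.nonneg (a + z)
        have h3 := hf.nonneg (-a + z); have h4 := hf.le_two_mul (0 + z)
        have h5 := hf.le_two_mul (a + z); have h6 := hf.le_two_mul (-a + z)
        rw [abs_le]; constructor <;> linarith) (fun N u => by
        -- Weight `1` on the shifted sample, `-1` on the sample itself.
        have h := hf.sum_family_nonneg (ι := Fin N ⊕ Fin N)
          (Sum.elim (fun i => a + u i) u) (Sum.elim (fun _ => 1) (fun _ => -1))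
        simp only [Fintype.sum_sum_type, Sum.elim_inl, Sum.elim_inr] at h
        simp only [← Finset.sum_add_distrib] at h
        refine h.trans_eq (Finset.sum_congr rfl fun i _ => Finset.sum_congr rfl fun j _ => ?_)
        rw [show a + u i - (a + u j) = 0 + (u i - u j) by abel,
          show a + u i - u j = a + (u i - u j) by abel,
          show u i - (a + u j) = -a + (u i - u j) by abel, zero_add]
        ring)
    have h1 := integral_two_mul_sub_add (hint 0) (hint a) (hint (-a))
    exact sub_nonneg.mp (h0.trans_eq h1)
  have hGint : IntegrableOn G S := by
    refine Integrable.integral_prod_left (μ := volume.restrict S) (ν := P.prod P)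
      (f := fun q => f (q.1 + (q.2.1 - q.2.2))) ?_
    exact .of_bound (C := 2 * f 0) (Continuous.aestronglyMeasurable (by fun_prop))
      (.of_forall fun p => hb _)
  have hSneg : -S = S := by
    ext x; exact ⟨fun hx => by simpa using hneg _ hx, fun hx => hneg x hx⟩
  have hrefl : ∫ a in S, G (-a) = ∫ a in S, G a := by
    have := (Measure.measurePreserving_neg (volume : Measure (EuclideanSpace ℝ (Fin n)))
      ).setIntegral_preimage_emb (MeasurableEquiv.neg _).measurableEmbedding G S
    rwa [Set.neg_preimage, hSneg] at this
  have hGint' : IntegrableOn (fun a => G (-a)) S := by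
    have := (Measure.measurePreserving_neg (volume : Measure (EuclideanSpace ℝ (Fin n)))
      ).integrableOn_comp_preimage (MeasurableEquiv.neg _).measurableEmbedding
      (f := G) (s := S)
    rw [Set.neg_preimage, hSneg] at this
    exact this.mpr hGint
  have hmono : ∫ a in S, (G a + G (-a)) ≤ ∫ _ in S, 2 * G 0 :=
    integral_mono (hGint.add hGint') (integrable_const _) hpt
  rw [integral_add hGint hGint', hrefl, setIntegral_const, smul_eq_mul, hG0] at hmono
  linarith

theorem IsSymmConvexBody.volume_real_pos {n : ℕ} {U : Set (EuclideanSpace ℝ (Fin n))}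
    (hU : IsSymmConvexBody U) : 0 < volume.real U :=
  ENNReal.toReal_pos (Measure.measure_pos_of_nonempty_interior _ hU.nonempty_interior).ne'
    hU.isCompact.measure_ne_top

theorem IsSymmConvexBody.smul {n : ℕ} {U : Set (EuclideanSpace ℝ (Fin n))}
    (hU : IsSymmConvexBody U) {r : ℝ} (hr : 0 < r) : IsSymmConvexBody (r • U) where
  convex := hU.convex.smul r
  isCompact := hU.isCompact.smul r
  nonempty_interior := by
    rw [interior_smul₀ hr.ne']; exact hU.nonempty_interior.smul_set
  neg_mem := by
    rintro _ ⟨x, hx, rfl⟩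
    exact ⟨-x, hU.neg_mem x hx, by simp⟩

theorem volume_real_smul_of_nonneg {n : ℕ} (U : Set (EuclideanSpace ℝ (Fin n))) {r : ℝ}
    (hr : 0 ≤ r) : volume.real (r • U) = r ^ n * volume.real U := by
  simp [Measure.real, Measure.addHaar_smul_of_nonneg _ hr, ENNReal.toReal_ofReal, hr]

theorem IsSymmConvexBody.sub_mem_of_mem_half {n : ℕ} {U : Set (EuclideanSpace ℝ (Fin n))}
    (hU : IsSymmConvexBody U) {u v : EuclideanSpace ℝ (Fin n)} (hu : u ∈ (1 / 2 : ℝ) • U)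
    (hv : v ∈ (1 / 2 : ℝ) • U) : u - v ∈ U := by
  obtain ⟨x, hx, rfl⟩ := hu
  obtain ⟨y, hy, rfl⟩ := hv
  have := hU.convex hx (hU.neg_mem y hy) (a := 1 / 2) (b := 1 / 2) (by norm_num) (by norm_num)
    (by norm_num)
  simpa [sub_eq_add_neg] using this

theorem setIntegral_comp_add_right {n : ℕ} {f : EuclideanSpace ℝ (Fin n) → ℝ}
    (z : EuclideanSpace ℝ (Fin n)) (S : Set (EuclideanSpace ℝ (Fin n))) :
    ∫ a in (fun a => a + z) ⁻¹' S, f (a + z) = ∫ a in S, f a :=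
  (measurePreserving_add_right volume z).setIntegral_preimage_emb
    (measurableEmbedding_addRight z) f S

theorem IsDoublePosDef.integrableOn {n : ℕ} {f : EuclideanSpace ℝ (Fin n) → ℝ}
    (hf : IsDoublePosDef f) {S : Set (EuclideanSpace ℝ (Fin n))} (hS : IsCompact S) :
    IntegrableOn f S := hf.continuous.continuousOn.integrableOn_compact hS

theorem IsDoublePosDef.setIntegral_le {n : ℕ} {f : EuclideanSpace ℝ (Fin n) → ℝ}
    (hf : IsDoublePosDef f) {U V : Set (EuclideanSpace ℝ (Fin n))} (hU : IsSymmConvexBody U)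
    (hV : IsSymmConvexBody V) :
    ∫ x in V, f x ≤ 2 ^ n * volume.real (V + U) / volume.real U * ∫ x in U, f x := by
  have hW : IsSymmConvexBody ((1 / 2 : ℝ) • U) := hU.smul (by norm_num)
  set W := (1 / 2 : ℝ) • U with hWdef
  have hWpos := hW.volume_real_pos
  let P : Measure (EuclideanSpace ℝ (Fin n)) := cond volume W
  have hWne : volume W ≠ 0 := fun h => by simp [Measure.real, h] at hWpos
  have : IsProbabilityMeasure P := cond_isProbabilityMeasure_of_finite hWne
    hW.isCompact.measure_ne_top
  have hPW : ∀ᵐ u ∂P, u ∈ W := ae_cond_mem hW.isCompact.measurableSet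
  have hc := hf.continuous
  have hb (x) : ‖f x‖ ≤ 2 * f 0 := by
    rw [Real.norm_of_nonneg (hf.nonneg x)]; exact hf.le_two_mul x
  have hprod : ∀ᵐ p ∂(P.prod P), p.1 ∈ W ∧ p.2 ∈ W := by
    rw [Filter.eventually_and]
    exact ⟨Measure.quasiMeasurePreserving_fst.ae hPW, Measure.quasiMeasurePreserving_snd.ae hPW⟩
  have hS : IsCompact (V + U) := hV.isCompact.add hU.isCompact
  have : IsFiniteMeasure (volume.restrict (V + U)) := ⟨by simpa using hS.measure_lt_top⟩
  have hSneg : ∀ x ∈ V + U, -x ∈ V + U := by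
    rintro _ ⟨v, hv, u, hu, rfl⟩
    exact ⟨-v, hV.neg_mem v hv, -u, hU.neg_mem u hu, by simp [add_comm]⟩
  have hupper : ∫ p, f (p.1 - p.2) ∂(P.prod P) ≤ (volume.real W)⁻¹ * ∫ x in U, f x := by
    have hi : Integrable (fun p : EuclideanSpace ℝ (Fin n) × EuclideanSpace ℝ (Fin n) =>
        f (p.1 - p.2)) (P.prod P) :=
      .of_bound (C := 2 * f 0) (Continuous.aestronglyMeasurable (by fun_prop))
        (.of_forall fun p => hb _)
    rw [integral_prod_symm _ hi]
    have hinner : ∀ᵐ v ∂P, ∫ u, f (u - v) ∂P ≤ (volume.real W)⁻¹ * ∫ x in U, f x := by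
      filter_upwards [hPW] with v hv
      have hcond : ∫ u, f (u - v) ∂P = (volume.real W)⁻¹ * ∫ u in W, f (u - v) := by
        simp [P, ProbabilityTheory.cond, Measure.real]
      rw [hcond]
      refine mul_le_mul_of_nonneg_left ?_ (by positivity)
      -- For fixed `v ∈ W`, the translate `W - v` lies in `U`.
      rw [← setIntegral_comp_add_right (-v) U]
      simp only [← sub_eq_add_neg]
      refine setIntegral_mono_set ?_ (.of_forall fun x => hf.nonneg _)
        (LE.le.eventuallyLE fun u hu => hU.sub_mem_of_mem_half hu hv)
      simpa only [← sub_eq_add_neg, Function.comp_def] using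
        ((measurePreserving_add_right volume (-v)).integrableOn_comp_preimage
          (measurableEmbedding_addRight (-v))).mpr (hf.integrableOn hU.isCompact)
    calc ∫ v, ∫ u, f (u - v) ∂P ∂P ≤ ∫ _, ((volume.real W)⁻¹ * ∫ x in U, f x) ∂P :=
          integral_mono_ae hi.integral_prod_right (integrable_const _) hinner
      _ = _ := by simp
  have hlower : ∫ x in V, f x ≤ ∫ a in V + U, ∫ p, f (a + (p.1 - p.2)) ∂(P.prod P) := by
    have hi : Integrable (fun q : EuclideanSpace ℝ (Fin n) ×
        (EuclideanSpace ℝ (Fin n) × EuclideanSpace ℝ (Fin n)) =>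
        f (q.1 + (q.2.1 - q.2.2))) ((volume.restrict (V + U)).prod (P.prod P)) :=
      .of_bound (C := 2 * f 0) (Continuous.aestronglyMeasurable (by fun_prop))
        (.of_forall fun p => hb _)
    rw [integral_integral_swap hi]
    have hinner : ∀ᵐ p ∂(P.prod P), ∫ x in V, f x ≤ ∫ a in V + U, f (a + (p.1 - p.2)) := by
      filter_upwards [hprod] with p hp
      rw [← setIntegral_comp_add_right (p.1 - p.2) V]
      refine setIntegral_mono_set ?_ (.of_forall fun x => hf.nonneg _)
        (LE.le.eventuallyLE fun a ha => ?_)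
      · exact Continuous.continuousOn (by fun_prop) |>.integrableOn_compact hS
      -- `a` is the point `a + (p.1 - p.2)` of `V` plus `p.2 - p.1 ∈ U`.
      · exact ⟨_, ha, p.2 - p.1, hU.sub_mem_of_mem_half hp.2 hp.1, by simp only; abel⟩
    calc ∫ x in V, f x = ∫ _, (∫ x in V, f x) ∂(P.prod P) := by simp
      _ ≤ _ := integral_mono_ae (integrable_const _) hi.integral_prod_right hinner
  have hvol : volume.real W = volume.real U / 2 ^ n := by
    rw [hWdef, volume_real_smul_of_nonneg U (by norm_num), one_div, inv_pow]; ring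
  calc ∫ x in V, f x ≤ volume.real (V + U) * ∫ p, f (p.1 - p.2) ∂(P.prod P) :=
        hlower.trans (hf.setIntegral_integral_le P hS hSneg)
    _ ≤ volume.real (V + U) * ((volume.real W)⁻¹ * ∫ x in U, f x) := by gcongr
    _ = _ := by rw [hvol, inv_div]; ring

theorem sharpConst_le {n : ℕ} {U V : Set (EuclideanSpace ℝ (Fin n))} (hU : IsSymmConvexBody U)
    (hV : IsSymmConvexBody V) :
    sharpConst U V ≤ ((2 ^ n * (volume.real (V + U) / volume.real V) : ℝ) : EReal) := by
  refine iSup_le fun f => iSup_le fun hf => iSup_le fun _ => EReal.coe_le_coe_iff.mpr ?_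
  have hUpos := hU.volume_real_pos
  have hVpos := hV.volume_real_pos
  have h0 : 0 ≤ ∫ x in U, f x := integral_nonneg fun x => hf.nonneg x
  refine div_le_of_le_mul₀ (by positivity) (by positivity) ?_
  calc 1 / volume.real V * ∫ x in V, f x
      ≤ 1 / volume.real V * (2 ^ n * volume.real (V + U) / volume.real U * ∫ x in U, f x) := by
        gcongr; exact hf.setIntegral_le hU hV
    _ = _ := by ring

/-- Although `log (log n)` is negative at `n = 2`, `log x ≥ 1 - 1 / x` and `log n > 0.69` keep it
above `-0.45`. -/
theorem one_le_covering_factor {n : ℕ} (hn : 2 ≤ n) :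
    (1 : ℝ) ≤ n * Real.log n + n * Real.log (Real.log n) + n := by
  have hn' : (2 : ℝ) ≤ n := by exact_mod_cast hn
  have hL : 0.69 < Real.log n :=
    lt_of_lt_of_le (by linarith [Real.log_two_gt_d9]) (Real.log_le_log (by norm_num) hn')
  have h1 := Real.one_sub_inv_le_log_of_pos (show 0 < Real.log n by linarith)
  have h2 : (Real.log n)⁻¹ ≤ 0.69⁻¹ := inv_anti₀ (by norm_num) hL.le
  norm_num at h2
  nlinarith

/-- The bound holds with `ε = 0`: averaging over all translates `a + U` with `a ∈ V + U` in place
of the translates of a covering gives `Cₙ(U, V) ≤ 2 ^ n * |V + U| / |V|`. -/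
theorem mainTheorem5 :
    ∃ ε : ℕ → ℝ,
      Asymptotics.IsLittleO Filter.atTop ε (fun n : ℕ => (n : ℝ)) ∧
      ∀ n : ℕ, 2 ≤ n →
        (∀ U V : Set (EuclideanSpace ℝ (Fin n)),
          IsSymmConvexBody U → IsSymmConvexBody V →
            sharpConst U V ≤
              (((2 : ℝ) ^ n *
                ((n : ℝ) * Real.log n + (n : ℝ) * Real.log (Real.log n) + (n : ℝ) + ε n) *
                (volume.real (V + U) / volume.real V) : ℝ) : EReal)) ∧
        (∀ U : Set (EuclideanSpace ℝ (Fin n)), IsSymmConvexBody U → ∀ r : ℝ, 0 < r →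
            sharpConst U (r • U) ≤
              (((2 : ℝ) ^ n *
                ((n : ℝ) * Real.log n + (n : ℝ) * Real.log (Real.log n) + (n : ℝ) + ε n) *
                (1 + 1 / r) ^ n : ℝ) : EReal)) := by
  refine ⟨0, Asymptotics.isLittleO_zero _ _, fun n hn => ?_⟩
  have hfac := one_le_covering_factor hn
  have first (U V : Set (EuclideanSpace ℝ (Fin n))) (hU : IsSymmConvexBody U)
      (hV : IsSymmConvexBody V) : sharpConst U V ≤ (((2 : ℝ) ^ n *
        (n * Real.log n + n * Real.log (Real.log n) + n + (0 : ℕ → ℝ) n) *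
          (volume.real (V + U) / volume.real V) : ℝ) : EReal) := by
    refine (sharpConst_le hU hV).trans (EReal.coe_le_coe_iff.mpr ?_)
    have hq : 0 ≤ volume.real (V + U) / volume.real V := by positivity
    rw [Pi.zero_apply, add_zero]
    gcongr
    exact le_mul_of_one_le_right (by positivity) hfac
  refine ⟨first, fun U hU r hr => ?_⟩
  have hUpos := hU.volume_real_pos
  have hsum : r • U + U = (r + 1) • U := by
    rw [hU.convex.add_smul hr.le zero_le_one, one_smul]
  have hvol : volume.real (r • U + U) / volume.real (r • U) = (1 + 1 / r) ^ n := by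
    rw [hsum, volume_real_smul_of_nonneg U (by positivity), volume_real_smul_of_nonneg U hr.le,
      mul_div_mul_right _ _ hUpos.ne', ← div_pow, add_div, div_self hr.ne']
  rw [← hvol]
  exact first U (r • U) hU (hU.smul hr)
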